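/- **Theorem (Gentzen).** Let $\mathcal L_{\mathsf{PA}}$ be the first-order language with $0$, $S$, $+$, $\times$, $\leq$, $=$, and let $\mathcal L_{\mathsf{PA}}^X$ be its extension by a unary predicate symbol $X$. Let $\mathsf{PA}[X]$ be the $\mathcal L_{\mathsf{PA}}^X$-theory whose axioms are the equality axioms (also for $X$), the axioms of Robinson arithmetic, and the (universal closures of the) induction axioms $\varphi[x/0]\land\forall x(\varphi\to\varphi[x/Sx])\to\forall x.\varphi$ for all $\mathcal L_{\mathsf{PA}}^X$-formulas $\varphi$. Let $\varepsilon_0$ be the set of terms, and $\prec$ the relation on it, that are defined simultaneously as follows: if $\alpha_0,\dots,\alpha_{n-1}\in\varepsilon_0$ ($n\geq 0$) satisfy $\alpha_i\prec\alpha_{i-1}$ or $\alpha_i=\alpha_{i-1}$ for $0<i<n$, then $\langle\alpha_0,\dots,\alpha_{n-1}\rangle\in\varepsilon_0$; and $\langle\alpha_0,\dots,\alpha_{m-1}\rangle\prec\langle\beta_0,\dots,\beta_{n-1}\rangle$ holds if and only if either $m<n$ and $\alpha_i=\beta_i$ for all $i<m$, or there is $j<\min(m,n)$ with $\alpha_j\prec\beta_j$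 and $\alpha_i=\beta_i$ for all $i<j$. Let $c:\varepsilon_0\to\mathbb N$ be any injective coding. Let $x\in\varepsilon_0$ and $y\prec x$ also denote any $\mathcal L_{\mathsf{PA}}$-formulas (with no free variables other than those displayed) that define the set $\{c(\alpha)\mid\alpha\in\varepsilon_0\}$ and the relation $\{(c(\beta),c(\alpha))\mid\beta\prec\alpha\}$ in the standard model $\mathbb N$. (For the usual codings this set and this relation are primitive recursive, so that such formulas exist.) Put $$\mathsf{TI}_\prec:\equiv\ \forall x\in\varepsilon_0\,\bigl(\forall y\,(y\prec x\to Xy)\to Xx\bigr)\ \to\ \forall x\in\varepsilon_0.\,Xx .$$ Then $\mathsf{PA}[X]$ does not prove $\mathsf{TI}_\prec$. -/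

import Mathlib

namespace Gentzen

/-! ## Terms and formulas of Peano arithmetic with an additional predicate symbol `X` -/

/-- Terms over `0, S, +, ×`. Variables are de Bruijn indices: below `d` quantifiers, the index `k < d`
is bound by the `k`-th enclosing quantifier (counted from the inside), and `d + k` is the free
variable number `k`. -/
inductive Term : Type
  | var (n : ℕ)
  | zero
  | succ (t : Term)
  | add (s t : Term)
  | mul (s t : Term)
  deriving DecidableEq

namespace Term

/-- Simultaneous substitution of `σ n` for the variable `n`. -/
def subst (σ : ℕ → Term) : Term → Term
  | var n => σ n
  | zero => zero
  | succ t => succ (t.subst σ)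
  | add s t => add (s.subst σ) (t.subst σ)
  | mul s t => mul (s.subst σ) (t.subst σ)

/-- `t.Occurs k`: the variable `k` occurs in `t`. -/
def Occurs (k : ℕ) : Term → Prop
  | var n => n = k
  | zero => False
  | succ t => t.Occurs k
  | add s t => s.Occurs k ∨ t.Occurs k
  | mul s t => s.Occurs k ∨ t.Occurs k

/-- The value of a term in the natural numbers under the variable assignment `v`. -/
def val (v : ℕ → ℕ) : Term → ℕ
  | var n => v n
  | zero => 0
  | succ t => t.val v + 1
  | add s t => s.val v + t.val v
  | mul s t => s.val v * t.val v

end Term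

/-- Prime formulas `s = t`, `s ≤ t` and `X t`. -/
inductive Atom : Type
  | eq (s t : Term)
  | le (s t : Term)
  | X (t : Term)
  deriving DecidableEq

namespace Atom

def subst (σ : ℕ → Term) : Atom → Atom
  | eq s t => eq (s.subst σ) (t.subst σ)
  | le s t => le (s.subst σ) (t.subst σ)
  | X t => X (t.subst σ)

def Occurs (k : ℕ) : Atom → Prop
  | eq s t => s.Occurs k ∨ t.Occurs k
  | le s t => s.Occurs k ∨ t.Occurs k
  | X t => t.Occurs k

/-- The prime formula does not involve the predicate symbol `X`. -/
def XFree : Atom → Prop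
  | eq _ _ => True
  | le _ _ => True
  | X _ => False

/-- Truth in the natural numbers, with `X` interpreted by the set `A`. -/
def Holds (A : Set ℕ) (v : ℕ → ℕ) : Atom → Prop
  | eq s t => s.val v = t.val v
  | le s t => s.val v ≤ t.val v
  | X t => t.val v ∈ A

end Atom

/-- Substitution below a quantifier. -/
def up (σ : ℕ → Term) : ℕ → Term
  | 0 => Term.var 0
  | n + 1 => (σ n).subst (fun k => Term.var (k + 1))

/-- The assignment `v` extended by the value `a` for a newly bound variable. -/
def extend (a : ℕ) (v : ℕ → ℕ) : ℕ → ℕ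
  | 0 => a
  | n + 1 => v n

/-- Formulas of arithmetic with the predicate symbol `X`, in negation normal form: they are built
from literals (prime formulas `pos a` and negated prime formulas `neg a`). -/
inductive Formula : Type
  | pos (a : Atom)
  | neg (a : Atom)
  | and (φ ψ : Formula)
  | or (φ ψ : Formula)
  | all (φ : Formula)
  | ex (φ : Formula)
  deriving DecidableEq

namespace Formula

/-- Negation, defined by de Morgan's rules and deletion of double negations. -/
def not : Formula → Formula
  | pos a => neg a
  | neg a => pos a
  | and φ ψ => or φ.not ψ.not
  | or φ ψ => and φ.not ψ.not
  | all φ => ex φ.not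
  | ex φ => all φ.not

def imp (φ ψ : Formula) : Formula := or φ.not ψ

def iff (φ ψ : Formula) : Formula := and (imp φ ψ) (imp ψ φ)

/-- Capture-avoiding simultaneous substitution. -/
def subst (σ : ℕ → Term) : Formula → Formula
  | pos a => pos (a.subst σ)
  | neg a => neg (a.subst σ)
  | and φ ψ => and (φ.subst σ) (ψ.subst σ)
  | or φ ψ => or (φ.subst σ) (ψ.subst σ)
  | all φ => all (φ.subst (up σ))
  | ex φ => ex (φ.subst (up σ))

/-- For a quantified formula `all φ` or `ex φ`, the instance `φ.inst t` arises from the body `φ` by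
substituting `t` for the bound variable. -/
def inst (φ : Formula) (t : Term) : Formula :=
  φ.subst fun n => match n with
    | 0 => t
    | k + 1 => Term.var k

/-- `φ[x/Sx]` for the variable `x` with index `0`. -/
def substSucc (φ : Formula) : Formula :=
  φ.subst fun n => match n with
    | 0 => Term.succ (Term.var 0)
    | k + 1 => Term.var (k + 1)

/-- `φ.FreeIn k`: the variable `k` is free in `φ`. -/
def FreeIn (k : ℕ) : Formula → Prop
  | pos a => a.Occurs k
  | neg a => a.Occurs k
  | and φ ψ => φ.FreeIn k ∨ ψ.FreeIn k
  | or φ ψ => φ.FreeIn k ∨ ψ.FreeIn k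
  | all φ => φ.FreeIn (k + 1)
  | ex φ => φ.FreeIn (k + 1)

/-- A sentence has no free variables. -/
def IsSentence (φ : Formula) : Prop := ∀ k, ¬ φ.FreeIn k

/-- The formula belongs to the language of Peano arithmetic, i.e. it does not involve `X`. -/
def XFree : Formula → Prop
  | pos a => a.XFree
  | neg a => a.XFree
  | and φ ψ => φ.XFree ∧ ψ.XFree
  | or φ ψ => φ.XFree ∧ ψ.XFree
  | all φ => φ.XFree
  | ex φ => φ.XFree

/-- Truth in the natural numbers, with `X` interpreted by the set `A`. -/
def Holds (A : Set ℕ) : (ℕ → ℕ) → Formula → Prop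
  | v, pos a => a.Holds A v
  | v, neg a => ¬ a.Holds A v
  | v, and φ ψ => φ.Holds A v ∧ ψ.Holds A v
  | v, or φ ψ => φ.Holds A v ∨ ψ.Holds A v
  | v, all φ => ∀ n : ℕ, φ.Holds A (extend n v)
  | v, ex φ => ∃ n : ℕ, φ.Holds A (extend n v)

/-- `∀ ... ∀ φ` with `n` quantifiers. -/
def allN : ℕ → Formula → Formula
  | 0, φ => φ
  | n + 1, φ => all (allN n φ)

end Formula

/-! ## Sequent calculus and the theory `PA[X]` -/

open Formula in
/-- Derivability in the Tait-style sequent calculus for predicate logic; sequents are finite sets. -/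
inductive Derivable : Finset Formula → Prop
  | ax (Δ : Finset Formula) (a : Atom) : Derivable (Δ ∪ {pos a, neg a})
  | and (Δ Γ : Finset Formula) (φ ψ : Formula) :
      Derivable (Γ ∪ {φ}) → Derivable (Γ ∪ {ψ}) → Derivable (Δ ∪ Γ ∪ {Formula.and φ ψ})
  | orLeft (Δ Γ : Finset Formula) (φ ψ : Formula) :
      Derivable (Γ ∪ {φ}) → Derivable (Δ ∪ Γ ∪ {Formula.or φ ψ})
  | orRight (Δ Γ : Finset Formula) (φ ψ : Formula) :
      Derivable (Γ ∪ {ψ}) → Derivable (Δ ∪ Γ ∪ {Formula.or φ ψ})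
  | all (Δ Γ : Finset Formula) (φ : Formula) (y : ℕ) :
      (∀ ψ ∈ Γ, ¬ ψ.FreeIn y) → ¬ (Formula.all φ).FreeIn y →
      Derivable (Γ ∪ {φ.inst (Term.var y)}) → Derivable (Δ ∪ Γ ∪ {Formula.all φ})
  | ex (Δ Γ : Finset Formula) (φ : Formula) (t : Term) :
      Derivable (Γ ∪ {φ.inst t}) → Derivable (Δ ∪ Γ ∪ {Formula.ex φ})
  | cut (Δ Γ : Finset Formula) (φ : Formula) :
      Derivable (Γ ∪ {φ}) → Derivable (Γ ∪ {φ.not}) → Derivable (Δ ∪ Γ)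

/-- The induction axiom `φ[x/0] ∧ ∀ x (φ → φ[x/Sx]) → ∀ x φ`, where `x` is the variable with index
`0` of `φ`; the other free variables of `φ` are parameters. -/
def inductionAxiom (φ : Formula) : Formula :=
  .imp (.and (φ.inst .zero) (.all (.imp φ φ.substSucc))) (.all φ)

open Formula Atom Term in
/-- The axioms of `PA[X]` (as sentences): equality axioms, the axioms of Robinson arithmetic, and the
universal closures of the induction axioms for all formulas, which may involve `X`. -/
inductive IsAxiom : Formula → Prop
  -- equality
  | eq_refl : IsAxiom (all (pos (eq (var 0) (var 0))))
  | eq_symm : IsAxiom (allN 2 (imp (pos (eq (var 1) (var 0))) (pos (eq (var 0) (var 1)))))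
  | eq_trans : IsAxiom (allN 3 (imp
      (.and (pos (eq (var 2) (var 1))) (pos (eq (var 1) (var 0))))
      (pos (eq (var 2) (var 0)))))
  | eq_succ : IsAxiom (allN 2 (imp (pos (eq (var 1) (var 0)))
      (pos (eq (succ (var 1)) (succ (var 0))))))
  | eq_add : IsAxiom (allN 4 (imp
      (.and (pos (eq (var 3) (var 2))) (pos (eq (var 1) (var 0))))
      (pos (eq (add (var 3) (var 1)) (add (var 2) (var 0))))))
  | eq_mul : IsAxiom (allN 4 (imp
      (.and (pos (eq (var 3) (var 2))) (pos (eq (var 1) (var 0))))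
      (pos (eq (mul (var 3) (var 1)) (mul (var 2) (var 0))))))
  | eq_le : IsAxiom (allN 4 (imp
      (.and (.and (pos (eq (var 3) (var 2))) (pos (eq (var 1) (var 0))))
        (pos (le (var 3) (var 1))))
      (pos (le (var 2) (var 0)))))
  | eq_X : IsAxiom (allN 2 (imp
      (.and (pos (eq (var 1) (var 0))) (pos (X (var 1)))) (pos (X (var 0)))))
  -- Robinson arithmetic
  | succ_ne_zero : IsAxiom (all (neg (eq (succ (var 0)) zero)))
  | succ_inj : IsAxiom (allN 2 (imp (pos (eq (succ (var 1)) (succ (var 0))))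
      (pos (eq (var 1) (var 0)))))
  | eq_succ_of_ne_zero : IsAxiom (all (imp (neg (eq (var 0) zero))
      (ex (pos (eq (var 1) (succ (var 0)))))))
  | add_zero : IsAxiom (all (pos (eq (add (var 0) zero) (var 0))))
  | add_succ : IsAxiom (allN 2
      (pos (eq (add (var 1) (succ (var 0))) (succ (add (var 1) (var 0))))))
  | mul_zero : IsAxiom (all (pos (eq (mul (var 0) zero) zero)))
  | mul_succ : IsAxiom (allN 2
      (pos (eq (mul (var 1) (succ (var 0))) (add (mul (var 1) (var 0)) (var 1)))))
  | le_iff : IsAxiom (allN 2 (Formula.iff (pos (le (var 1) (var 0)))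
      (ex (pos (eq (add (var 0) (var 2)) (var 1))))))
  -- induction
  | induction (φ : Formula) (n : ℕ) :
      (allN n (inductionAxiom φ)).IsSentence → IsAxiom (allN n (inductionAxiom φ))

/-- `PA[X] ⊢ φ`: the sequent `¬ψ₁, ..., ¬ψₙ, φ` is derivable for finitely many axioms `ψᵢ`. -/
def PAXProves (φ : Formula) : Prop :=
  ∃ Ψ : Finset Formula, (∀ ψ ∈ Ψ, IsAxiom ψ) ∧ Derivable (Ψ.image Formula.not ∪ {φ})

/-! ## The notation system `ε₀` -/

/-- Finite rooted trees with an order on the successors of each node: `node [α₀, ..., αₙ₋₁]` is the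
syntactic expression `⟨α₀, ..., αₙ₋₁⟩`. -/
inductive Tree : Type
  | node (l : List Tree)

/-- The lexicographic comparison `≺` on trees. -/
inductive Tree.Prec : Tree → Tree → Prop
  | initial (l : List Tree) (b : Tree) (s : List Tree) :
      Prec (.node l) (.node (l ++ b :: s))
  | diff (l : List Tree) (a b : Tree) (r s : List Tree) :
      Prec a b → Prec (.node (l ++ a :: r)) (.node (l ++ b :: s))

/-- The set `ε₀` of terms `⟨α₀, ..., αₙ₋₁⟩` with `αᵢ ∈ ε₀` and `αᵢ ⪯ αᵢ₋₁` for `0 < i < n`. -/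
inductive Tree.MemEpsilonZero : Tree → Prop
  | node (l : List Tree) :
      (∀ a ∈ l, MemEpsilonZero a) →
      l.IsChain (fun a b => Tree.Prec b a ∨ b = a) →
      MemEpsilonZero (.node l)

/-- The notation system `ε₀`, ordered by `Tree.Prec`. -/
def EpsilonZero : Type := {α : Tree // α.MemEpsilonZero}

/-- `δ` is a formula of the language of Peano arithmetic with the only free variable `0` that defines
the set `{c α ∣ α ∈ ε₀}` of codes in the standard model. -/
def DefinesField (c : EpsilonZero → ℕ) (δ : Formula) : Prop :=
  δ.XFree ∧ (∀ k, δ.FreeIn k → k < 1) ∧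
    ∀ (A : Set ℕ) (v : ℕ → ℕ), δ.Holds A v ↔ ∃ α, c α = v 0

/-- `ρ` is a formula of the language of Peano arithmetic with the free variables `0, 1` that defines
the relation `{(c α, c β) ∣ α ≺ β}` in the standard model (variable `0` is the left argument and
variable `1` the right one). -/
def DefinesPrec (c : EpsilonZero → ℕ) (ρ : Formula) : Prop :=
  ρ.XFree ∧ (∀ k, ρ.FreeIn k → k < 2) ∧
    ∀ (A : Set ℕ) (v : ℕ → ℕ), ρ.Holds A v ↔
      ∃ α β : EpsilonZero, Tree.Prec α.1 β.1 ∧ c α = v 0 ∧ c β = v 1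

/-- `∀ α ∈ ε₀ (∀ β ≺ α. X β → X α)`. -/
def progFormula (δ ρ : Formula) : Formula :=
  .all (.imp δ (.imp (.all (.imp ρ (.pos (.X (.var 0))))) (.pos (.X (.var 0)))))

/-- Transfinite induction: `Prog → ∀ α ∈ ε₀. X α`. -/
def tiFormula (δ ρ : Formula) : Formula :=
  .imp (progFormula δ ρ) (.all (.imp δ (.pos (.X (.var 0)))))

end Gentzen

namespace Gentzen

open Ordinal

/-! ## Infinitary propositional logic over the atoms `X n` -/

-- The proof is Gentzen's ordinal analysis by the ω-rule. Quantifiers become conjunctions and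
-- disjunctions over ℕ, and arithmetical prime formulas are evaluated, so that only the literals of
-- `X n` remain. Each use of induction is replaced by infinitely many finite derivations, one for
-- each numeral. Hence a proof in `PA[X]` yields an infinitary derivation of height below `ε₀` with
-- finite cut rank (`PAXProves.infProvable`).
--
-- Lowering the cut rank by one turns the height `α` into `ω ^ α` (`InfDer.lower_cut_rank`). As `ε₀`
-- is closed under this operation and the rank is finite, all cuts can be removed below `ε₀`.
--
-- A cut-free derivation of small height cannot prove much induction (`InfDer.boundedness`). Read
-- positive occurrences of `X` as "value below `β + ω ^ α`" and negative ones as "value below `β`".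
-- One appeal to progressivity raises the bound by one only, so a derivation of height `α` stays
-- within these bounds. For transfinite induction this means that all notations have value below `ω
-- ^ α` for some `α < ε₀`. But Cantor normal forms give notations for all ordinals below `ε₀`
-- (`Tree.exists_ord_eq`), in particular for `ω ^ α`.

/-- Infinitary propositional formulas in negation normal form. The formula `conj s f` is the
conjunction of all `f i` with `i ∈ s`, and `disj s f` is their disjunction. -/
inductive InfForm : Type
  | pos (n : ℕ)
  | neg (n : ℕ)
  | conj (s : Set ℕ) (f : ℕ → InfForm)
  | disj (s : Set ℕ) (f : ℕ → InfForm)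

namespace InfForm

def not : InfForm → InfForm
  | pos n => neg n
  | neg n => pos n
  | conj s f => disj s fun i => (f i).not
  | disj s f => conj s fun i => (f i).not

@[simp] theorem not_not (φ : InfForm) : φ.not.not = φ := by
  induction φ with
  | pos n => rfl
  | neg n => rfl
  | conj s f ih => simp [not, ih]
  | disj s f ih => simp [not, ih]

/-- The rank of the formula is smaller than `r`. -/
def RankLT : InfForm → ℕ → Prop
  | pos _, r => 0 < r
  | neg _, r => 0 < r
  | conj s f, r => ∃ q < r, ∀ i ∈ s, (f i).RankLT q
  | disj s f, r => ∃ q < r, ∀ i ∈ s, (f i).RankLT q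

theorem RankLT.mono {φ : InfForm} {q r : ℕ} (h : φ.RankLT q) (hqr : q ≤ r) : φ.RankLT r := by
  cases φ with
  | pos n => exact lt_of_lt_of_le h hqr
  | neg n => exact lt_of_lt_of_le h hqr
  | conj s f => obtain ⟨p, hp, h⟩ := h; exact ⟨p, hp.trans_le hqr, h⟩
  | disj s f => obtain ⟨p, hp, h⟩ := h; exact ⟨p, hp.trans_le hqr, h⟩

theorem not_rankLT_zero (φ : InfForm) : ¬ φ.RankLT 0 := by
  cases φ <;> simp [RankLT]

theorem RankLT.not {φ : InfForm} {r : ℕ} (h : φ.RankLT r) : φ.not.RankLT r := by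
  induction φ generalizing r with
  | pos n => exact h
  | neg n => exact h
  | conj s f ih => obtain ⟨q, hq, h⟩ := h; exact ⟨q, hq, fun i hi => ih i (h i hi)⟩
  | disj s f ih => obtain ⟨q, hq, h⟩ := h; exact ⟨q, hq, fun i hi => ih i (h i hi)⟩

/-- Truth when positive occurrences of `X` are interpreted by `P` and negative ones by `N`. -/
def AsymHolds (P N : Set ℕ) : InfForm → Prop
  | pos n => n ∈ P
  | neg n => n ∉ N
  | conj s f => ∀ i ∈ s, (f i).AsymHolds P N
  | disj s f => ∃ i ∈ s, (f i).AsymHolds P N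

theorem AsymHolds.mono {φ : InfForm} {P P' N N' : Set ℕ} (h : φ.AsymHolds P N) (hP : P ⊆ P')
    (hN : N' ⊆ N) : φ.AsymHolds P' N' := by
  induction φ with
  | pos n => exact hP h
  | neg n => exact fun hn => h (hN hn)
  | conj s f ih => exact fun i hi => ih i (h i hi)
  | disj s f ih => obtain ⟨i, hi, h⟩ := h; exact ⟨i, hi, ih i h⟩

end InfForm

open InfForm

/-- Derivability in infinitary propositional logic with height `α` and all cut formulas of rank
smaller than `r`. -/
inductive InfDer (r : ℕ) : Ordinal.{0} → Set InfForm → Prop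
  | ax {α : Ordinal} {Γ : Set InfForm} (n : ℕ) : pos n ∈ Γ → neg n ∈ Γ → InfDer r α Γ
  | conj {α : Ordinal} {Γ : Set InfForm} (s : Set ℕ) (f : ℕ → InfForm) (β : ℕ → Ordinal) :
      InfForm.conj s f ∈ Γ → (∀ i ∈ s, β i < α) → (∀ i ∈ s, InfDer r (β i) (insert (f i) Γ)) →
      InfDer r α Γ
  | disj {α β : Ordinal} {Γ : Set InfForm} (s : Set ℕ) (f : ℕ → InfForm) (i : ℕ) :
      InfForm.disj s f ∈ Γ → i ∈ s → β < α → InfDer r β (insert (f i) Γ) → InfDer r α Γ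
  | cut {α β γ : Ordinal} {Γ : Set InfForm} (φ : InfForm) : φ.RankLT r → β < α → γ < α →
      InfDer r β (insert φ Γ) → InfDer r γ (insert φ.not Γ) → InfDer r α Γ

-- Cut elimination and boundedness

namespace InfDer

theorem mono {r r' : ℕ} {α α' : Ordinal} {Γ Γ' : Set InfForm} (h : InfDer r α Γ) (hr : r ≤ r')
    (hα : α ≤ α') (hΓ : Γ ⊆ Γ') : InfDer r' α' Γ' := by
  induction h generalizing α' Γ' with
  | ax n h1 h2 => exact .ax n (hΓ h1) (hΓ h2)
  | conj s f β h1 h2 _ ih =>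
    exact .conj s f β (hΓ h1) (fun i hi => (h2 i hi).trans_le hα)
      (fun i hi => ih i hi le_rfl (Set.insert_subset_insert hΓ))
  | disj s f i h1 h2 h3 _ ih =>
    exact .disj s f i (hΓ h1) h2 (h3.trans_le hα) (ih le_rfl (Set.insert_subset_insert hΓ))
  | cut φ h1 h2 h3 _ _ ih1 ih2 =>
    exact .cut φ (h1.mono hr) (h2.trans_le hα) (h3.trans_le hα)
      (ih1 le_rfl (Set.insert_subset_insert hΓ)) (ih2 le_rfl (Set.insert_subset_insert hΓ))

/-- Premises keep the principal formula, so contexts are compared by inclusion only. Where the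
conjunction is principal, the `i`-th premise already contains `f i`, and the two copies merge. -/
theorem conj_inversion {r : ℕ} {α : Ordinal} {Γ Δ : Set InfForm} {s : Set ℕ} {f : ℕ → InfForm}
    {i : ℕ} (h : InfDer r α Γ) (hi : i ∈ s) (hΓ : Γ ⊆ insert (InfForm.conj s f) Δ) :
    InfDer r α (insert (f i) Δ) := by
  induction h generalizing Δ with
  | ax n h1 h2 =>
    have h1 := hΓ h1
    have h2 := hΓ h2
    simp only [Set.mem_insert_iff, reduceCtorEq, false_or] at h1 h2
    exact .ax n (.inr h1) (.inr h2)
  | @conj α Γ t g β h1 h2 h3 ih =>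
    rcases hΓ h1 with h | h
    · cases h
      refine (ih i hi (Δ := insert (f i) Δ) ?_).mono le_rfl (h2 i hi).le (by simp)
      rw [Set.insert_comm]
      exact Set.insert_subset_insert hΓ
    · refine .conj t g β (.inr h) h2 fun j hj => ?_
      rw [Set.insert_comm]
      refine ih j hj ?_
      rw [Set.insert_comm]
      exact Set.insert_subset_insert hΓ
  | disj t g j h1 h2 h3 _ ih =>
    have h1 := hΓ h1
    simp only [Set.mem_insert_iff, reduceCtorEq, false_or] at h1
    refine .disj t g j (.inr h1) h2 h3 ?_
    rw [Set.insert_comm]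
    refine ih ?_
    rw [Set.insert_comm]
    exact Set.insert_subset_insert hΓ
  | cut φ h1 h2 h3 _ _ ih1 ih2 =>
    refine .cut φ h1 h2 h3 ?_ ?_ <;> rw [Set.insert_comm]
    · refine ih1 ?_
      rw [Set.insert_comm]
      exact Set.insert_subset_insert hΓ
    · refine ih2 ?_
      rw [Set.insert_comm]
      exact Set.insert_subset_insert hΓ

/-- The literal `neg n` is principal only in axioms. There `pos n` lies in the context, and the
derivation `hα` can be grafted in. All other rules commute with the cut. -/
theorem cut_pos {r n : ℕ} {α β : Ordinal} {Γ Δ : Set InfForm} (h : InfDer r β Γ)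
    (hΓ : Γ ⊆ insert (InfForm.neg n) Δ) (hα : InfDer r α (insert (InfForm.pos n) Δ)) :
    InfDer r (α + β) Δ := by
  have aux {Γ Δ : Set InfForm} {φ ψ : InfForm} (h : Γ ⊆ insert φ Δ) :
      insert ψ Γ ⊆ insert φ (insert ψ Δ) := by
    rw [Set.insert_comm]; exact Set.insert_subset_insert h
  have weak {Δ : Set InfForm} {φ ψ : InfForm} (h : InfDer r α (insert φ Δ)) :
      InfDer r α (insert φ (insert ψ Δ)) :=
    h.mono le_rfl le_rfl (Set.insert_subset_insert (Set.subset_insert _ _))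
  induction h generalizing Δ with
  | ax m h1 h2 =>
    have h1 := hΓ h1
    simp only [Set.mem_insert_iff, reduceCtorEq, false_or] at h1
    rcases hΓ h2 with h | h
    · cases h
      rw [Set.insert_eq_of_mem h1] at hα
      exact hα.mono le_rfl le_self_add subset_rfl
    · exact .ax m h1 h
  | conj s f β h1 h2 _ ih =>
    have h1 := hΓ h1
    simp only [Set.mem_insert_iff, reduceCtorEq, false_or] at h1
    exact .conj s f _ h1 (fun i hi => (add_lt_add_iff_left α).2 (h2 i hi))
      (fun i hi => ih i hi (aux hΓ) (weak hα))
  | disj s f i h1 h2 h3 _ ih =>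
    have h1 := hΓ h1
    simp only [Set.mem_insert_iff, reduceCtorEq, false_or] at h1
    exact .disj s f i h1 h2 ((add_lt_add_iff_left α).2 h3) (ih (aux hΓ) (weak hα))
  | cut φ h1 h2 h3 _ _ ih1 ih2 =>
    exact .cut φ h1 ((add_lt_add_iff_left α).2 h2) ((add_lt_add_iff_left α).2 h3)
      (ih1 (aux hΓ) (weak hα)) (ih2 (aux hΓ) (weak hα))

/-- Where the negated conjunction is principal, with the disjunct `(f i).not`, the other derivation
is inverted at `i` and the cut moves to `f i`. The height `β` of the traversed derivation is the
right summand, in which addition is strictly monotone. -/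
theorem cut_conj {r : ℕ} {s : Set ℕ} {f : ℕ → InfForm} (hf : ∀ i ∈ s, (f i).RankLT r)
    {α β : Ordinal} {Γ Δ : Set InfForm} (h : InfDer r β Γ)
    (hΓ : Γ ⊆ insert (InfForm.conj s f).not Δ) (hα : InfDer r α (insert (InfForm.conj s f) Δ)) :
    InfDer r (α + β) Δ := by
  have aux {Γ Δ : Set InfForm} {φ ψ : InfForm} (h : Γ ⊆ insert φ Δ) :
      insert ψ Γ ⊆ insert φ (insert ψ Δ) := by
    rw [Set.insert_comm]; exact Set.insert_subset_insert h
  have weak {Δ : Set InfForm} {φ ψ : InfForm} (h : InfDer r α (insert φ Δ)) :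
      InfDer r α (insert φ (insert ψ Δ)) :=
    h.mono le_rfl le_rfl (Set.insert_subset_insert (Set.subset_insert _ _))
  induction h generalizing Δ with
  | ax m h1 h2 =>
    have h1 := hΓ h1
    have h2 := hΓ h2
    simp only [Set.mem_insert_iff, reduceCtorEq, false_or, InfForm.not] at h1 h2
    exact .ax m h1 h2
  | conj t g β h1 h2 _ ih =>
    have h1 := hΓ h1
    simp only [Set.mem_insert_iff, reduceCtorEq, false_or, InfForm.not] at h1
    exact .conj t g _ h1 (fun i hi => (add_lt_add_iff_left α).2 (h2 i hi))
      (fun i hi => ih i hi (aux hΓ) (weak hα))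
  | disj t g i h1 h2 h3 _ ih =>
    have lt := (add_lt_add_iff_left α).2 h3
    rcases hΓ h1 with h | h
    · cases h
      exact .cut (f i) (hf i h2) (le_self_add.trans_lt lt) lt
        ((hα.conj_inversion h2 subset_rfl).mono le_rfl le_rfl subset_rfl) (ih (aux hΓ) (weak hα))
    · exact .disj t g i h h2 lt (ih (aux hΓ) (weak hα))
  | cut φ h1 h2 h3 _ _ ih1 ih2 =>
    exact .cut φ h1 ((add_lt_add_iff_left α).2 h2) ((add_lt_add_iff_left α).2 h3)
      (ih1 (aux hΓ) (weak hα)) (ih2 (aux hΓ) (weak hα))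

/-- A cut can be replaced by cuts of smaller rank. -/
theorem reduce_cut {r : ℕ} {φ : InfForm} (hφ : φ.RankLT (r + 1)) {α β : Ordinal}
    {Γ : Set InfForm} (h : InfDer r α (insert φ Γ)) (h' : InfDer r β (insert φ.not Γ)) :
    InfDer r (α + β) Γ ∨ InfDer r (β + α) Γ := by
  cases φ with
  | pos n => exact .inl (cut_pos h' subset_rfl h)
  | neg n => exact .inr (cut_pos h subset_rfl h')
  | conj s f =>
    obtain ⟨q, hq, hf⟩ := hφ
    exact .inl (cut_conj (fun i hi => (hf i hi).mono (Nat.le_of_lt_succ hq)) h' subset_rfl h)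
  | disj s f =>
    obtain ⟨q, hq, hf⟩ := hφ
    -- The disjunction is the negation of the conjunction of the `(f i).not`, so the two derivations
    -- swap roles and the summands their order.
    refine .inr (cut_conj (f := fun i => (f i).not) (Γ := insert (InfForm.disj s f) Γ)
      (fun i hi => (hf i hi).not.mono (Nat.le_of_lt_succ hq)) h ?_ h')
    simp [InfForm.not]

theorem opow_add_opow_lt {α β γ : Ordinal} (hβ : β < α) (hγ : γ < α) : ω ^ β + ω ^ γ < ω ^ α :=
  isPrincipal_add_omega0_opow α ((opow_lt_opow_iff_right one_lt_omega0).2 hβ)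
    ((opow_lt_opow_iff_right one_lt_omega0).2 hγ)

/-- Powers of `ω` are closed under addition, so the sum of the transformed premise heights, in
either order, stays below `ω ^ α`. -/
theorem lower_cut_rank {r : ℕ} {α : Ordinal} {Γ : Set InfForm} (h : InfDer (r + 1) α Γ) :
    InfDer r (ω ^ α) Γ := by
  induction h with
  | ax n h1 h2 => exact .ax n h1 h2
  | conj s f β h1 h2 _ ih =>
    exact .conj s f _ h1 (fun i hi => (opow_lt_opow_iff_right one_lt_omega0).2 (h2 i hi)) ih
  | disj s f i h1 h2 h3 _ ih =>
    exact .disj s f i h1 h2 ((opow_lt_opow_iff_right one_lt_omega0).2 h3) ih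
  | cut φ h1 h2 h3 _ _ ih1 ih2 =>
    rcases reduce_cut h1 ih1 ih2 with h | h
    · exact h.mono le_rfl (opow_add_opow_lt h2 h3).le subset_rfl
    · exact h.mono le_rfl (opow_add_opow_lt h3 h2).le subset_rfl

open scoped Ordinal in
theorem omega0_opow_lt_epsilon_zero {α : Ordinal} (h : α < ε₀) : ω ^ α < ε₀ := by
  rw [← omega0_opow_epsilon 0]
  exact (opow_lt_opow_iff_right one_lt_omega0).2 h

open scoped Ordinal in
theorem cut_elimination {r : ℕ} {α : Ordinal} {Γ : Set InfForm} (h : InfDer r α Γ) (hα : α < ε₀) :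
    ∃ β < ε₀, InfDer 0 β Γ := by
  induction r generalizing α with
  | zero => exact ⟨α, hα, h⟩
  | succ r ih => exact ih h.lower_cut_rank (omega0_opow_lt_epsilon_zero hα)

/-- Boundedness: the formula `disj s g` plays the role of the negated progressivity of `X`. -/
theorem boundedness {A : Ordinal → Set ℕ} (hA : Monotone A) {s : Set ℕ} {g : ℕ → InfForm}
    (hg : ∀ i ∈ s, ∀ (γ : Ordinal) (N P : Set ℕ),
      (g i).AsymHolds (A γ) N → ¬ (g i).AsymHolds P (A (γ + 1)))
    {α : Ordinal} {Γ Δ : Set InfForm} (h : InfDer 0 α Γ) (hΓ : Γ ⊆ insert (InfForm.disj s g) Δ)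
    (β : Ordinal) : ∃ φ ∈ Δ, φ.AsymHolds (A (β + ω ^ α)) (A β) := by
  have aux {Γ Δ : Set InfForm} {φ ψ : InfForm} (h : Γ ⊆ insert φ Δ) :
      insert ψ Γ ⊆ insert φ (insert ψ Δ) := by
    rw [Set.insert_comm]; exact Set.insert_subset_insert h
  induction h generalizing Δ β with
  | ax n h1 h2 =>
    have h1 := hΓ h1
    have h2 := hΓ h2
    simp only [Set.mem_insert_iff, reduceCtorEq, false_or] at h1 h2
    -- The positive reading of `X` contains the negative one, so one of the two literals holds.
    by_cases hn : n ∈ A β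
    · exact ⟨_, h1, hA le_self_add hn⟩
    · exact ⟨_, h2, hn⟩
  | @conj α Γ t f δ h1 h2 _ ih =>
    have h1 := hΓ h1
    simp only [Set.mem_insert_iff, reduceCtorEq, false_or] at h1
    by_contra! hc
    refine hc _ h1 fun i hi => ?_
    have le : ω ^ δ i ≤ ω ^ α := opow_le_opow_right omega0_pos (h2 i hi).le
    obtain ⟨φ, hφ, h⟩ := ih i hi (aux hΓ) β
    have h := h.mono (hA (add_le_add_right le β)) subset_rfl
    rcases hφ with rfl | hφ
    · exact h
    · exact absurd h (hc φ hφ)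
  | @disj α δ Γ t f i h1 h2 h3 _ ih =>
    have le : ω ^ δ ≤ ω ^ α := opow_le_opow_right omega0_pos h3.le
    obtain ⟨φ, hφ, h⟩ := ih (aux hΓ) β
    have h' := h.mono (hA (add_le_add_right le β)) subset_rfl
    rcases hφ with rfl | hφ
    · rcases hΓ h1 with h1 | h1
      · cases h1
        -- By the first appeal to `ih`, the positive part of `g i` is bounded by `β + ω ^ δ`. By
        -- `hg` this refutes `g i` over the next base, so a second appeal there gives a formula of
        -- `Δ`. The total increment `ω ^ δ + 1 + ω ^ δ` is below `ω ^ α`.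
        obtain ⟨ψ, hψ, h''⟩ := ih (aux hΓ) (β + ω ^ δ + 1)
        rcases hψ with rfl | hψ
        · exact absurd h'' (hg i h2 _ _ _ h)
        · refine ⟨ψ, hψ, h''.mono (hA ?_) (hA ?_)⟩
          · rw [add_assoc, add_assoc]
            refine add_le_add_right ?_ β
            have lt : ω ^ δ < ω ^ α := (opow_lt_opow_iff_right one_lt_omega0).2 h3
            have one : (1 : Ordinal) < ω ^ α :=
              (Order.one_le_iff_pos.2 (opow_pos δ omega0_pos)).trans_lt lt
            exact (isPrincipal_add_omega0_opow α lt
              (isPrincipal_add_omega0_opow α one lt)).le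
          · rw [add_assoc]
            exact le_self_add
      · exact ⟨_, h1, i, h2, h'⟩
    · exact ⟨φ, hφ, h'⟩
  | cut φ h1 => exact absurd h1 (not_rankLT_zero φ)

end InfDer

end Gentzen

namespace Gentzen

open Ordinal InfForm

/-! ## Translation of arithmetical formulas -/

namespace InfForm

def top : InfForm := conj ∅ fun _ => pos 0

/-- The family with members `φ` and `ψ`. -/
def pair (φ ψ : InfForm) : ℕ → InfForm
  | 0 => φ
  -- All positive indices repeat `ψ`, so that binary connectives can use the index set `univ`.
  | _ + 1 => ψ

theorem not_pair (φ ψ : InfForm) : (fun i => (pair φ ψ i).not) = pair φ.not ψ.not := by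
  funext i; cases i <;> rfl

theorem asymHolds_and {φ ψ : InfForm} {P N : Set ℕ} :
    (conj .univ (pair φ ψ)).AsymHolds P N ↔ φ.AsymHolds P N ∧ ψ.AsymHolds P N := by
  refine ⟨fun h => ⟨h 0 trivial, h 1 trivial⟩, fun h i _ => ?_⟩
  cases i
  exacts [h.1, h.2]

theorem asymHolds_or {φ ψ : InfForm} {P N : Set ℕ} :
    (disj .univ (pair φ ψ)).AsymHolds P N ↔ φ.AsymHolds P N ∨ ψ.AsymHolds P N := by
  constructor
  · rintro ⟨i, -, h⟩
    cases i
    exacts [.inl h, .inr h]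
  · rintro (h | h)
    exacts [⟨0, trivial, h⟩, ⟨1, trivial, h⟩]

end InfForm

def Atom.toInf (v : ℕ → ℕ) : Atom → InfForm
  | .eq s t => if s.val v = t.val v then top else top.not
  | .le s t => if s.val v ≤ t.val v then top else top.not
  | .X t => .pos (t.val v)

namespace Formula

/-- The infinitary propositional formula that expresses `φ` under the assignment `v`. -/
def toInf : (ℕ → ℕ) → Formula → InfForm
  | v, pos a => a.toInf v
  | v, neg a => (a.toInf v).not
  | v, and φ ψ => .conj .univ (pair (φ.toInf v) (ψ.toInf v))
  | v, or φ ψ => .disj .univ (pair (φ.toInf v) (ψ.toInf v))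
  | v, all φ => .conj .univ fun n => φ.toInf (extend n v)
  | v, ex φ => .disj .univ fun n => φ.toInf (extend n v)

end Formula

theorem Term.val_subst (σ : ℕ → Term) (v : ℕ → ℕ) (t : Term) :
    (t.subst σ).val v = t.val fun n => (σ n).val v := by
  induction t <;> simp_all [subst, val]

theorem Term.val_congr {v w : ℕ → ℕ} {t : Term} (h : ∀ k, t.Occurs k → v k = w k) :
    t.val v = t.val w := by
  induction t with
  | var n => exact h n rfl
  | zero => rfl
  | succ t ih => simp [val, ih h]
  | add s t ih1 ih2 => simp [val, ih1 fun k hk => h k (.inl hk), ih2 fun k hk => h k (.inr hk)]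
  | mul s t ih1 ih2 => simp [val, ih1 fun k hk => h k (.inl hk), ih2 fun k hk => h k (.inr hk)]

theorem Atom.toInf_subst (σ : ℕ → Term) (v : ℕ → ℕ) (a : Atom) :
    (a.subst σ).toInf v = a.toInf fun n => (σ n).val v := by
  cases a <;> simp [subst, toInf, Term.val_subst]

theorem Atom.toInf_congr {v w : ℕ → ℕ} {a : Atom} (h : ∀ k, a.Occurs k → v k = w k) :
    a.toInf v = a.toInf w := by
  cases a with
  | eq s t => simp [toInf, Term.val_congr fun k hk => h k (.inl hk),
      Term.val_congr fun k hk => h k (.inr hk)]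
  | le s t => simp [toInf, Term.val_congr fun k hk => h k (.inl hk),
      Term.val_congr fun k hk => h k (.inr hk)]
  | X t => simp [toInf, Term.val_congr h]

theorem val_up (σ : ℕ → Term) (v : ℕ → ℕ) (a : ℕ) :
    (fun n => (up σ n).val (extend a v)) = extend a fun n => (σ n).val v := by
  funext n
  cases n <;> simp [up, extend, Term.val, Term.val_subst]

namespace Formula

theorem toInf_subst (σ : ℕ → Term) (v : ℕ → ℕ) (φ : Formula) :
    (φ.subst σ).toInf v = φ.toInf fun n => (σ n).val v := by
  induction φ generalizing σ v <;> simp_all [subst, toInf, Atom.toInf_subst, val_up]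

theorem toInf_inst (v : ℕ → ℕ) (φ : Formula) (t : Term) :
    (φ.inst t).toInf v = φ.toInf (extend (t.val v) v) := by
  rw [inst, toInf_subst]
  congr 1
  funext n
  cases n <;> rfl

theorem toInf_substSucc (v : ℕ → ℕ) (φ : Formula) (n : ℕ) :
    φ.substSucc.toInf (extend n v) = φ.toInf (extend (n + 1) v) := by
  rw [substSucc, toInf_subst]
  congr 1
  funext n
  cases n <;> rfl

/-- Through this fact the eigenvariable condition enters the embedding of the `∀`-rule. -/
theorem toInf_congr {v w : ℕ → ℕ} {φ : Formula} (h : ∀ k, φ.FreeIn k → v k = w k) :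
    φ.toInf v = φ.toInf w := by
  have aux {φ : Formula} {v w : ℕ → ℕ} (h : ∀ k, φ.FreeIn (k + 1) → v k = w k) (n k : ℕ)
      (hk : φ.FreeIn k) : extend n v k = extend n w k := by
    cases k with
    | zero => rfl
    | succ k => exact h k hk
  induction φ generalizing v w with
  | pos a => exact Atom.toInf_congr h
  | neg a => exact congrArg _ (Atom.toInf_congr h)
  | and φ ψ ih1 ih2 =>
    simp [toInf, ih1 fun k hk => h k (.inl hk), ih2 fun k hk => h k (.inr hk)]
  | or φ ψ ih1 ih2 =>
    simp [toInf, ih1 fun k hk => h k (.inl hk), ih2 fun k hk => h k (.inr hk)]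
  | all φ ih => simp only [toInf, fun n => ih (aux h n)]
  | ex φ ih => simp only [toInf, fun n => ih (aux h n)]

theorem toInf_not (v : ℕ → ℕ) (φ : Formula) : φ.not.toInf v = (φ.toInf v).not := by
  induction φ generalizing v <;> simp_all [not, toInf, InfForm.not, not_pair]

/-- The rank depends on the logical structure and not on the assignment. This uniformity keeps cut
ranks finite despite infinite branching. -/
theorem exists_rankLT_toInf (φ : Formula) : ∃ r, ∀ v, (φ.toInf v).RankLT r := by
  have atom (a : Atom) (v : ℕ → ℕ) : (a.toInf v).RankLT 1 := by
    cases a <;> simp only [Atom.toInf] <;> (try split) <;> simp [top, InfForm.not, RankLT]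
  have pair {φ ψ : InfForm} {p q : ℕ} (h : φ.RankLT p) (h' : ψ.RankLT q) (i : ℕ) :
      (pair φ ψ i).RankLT (max p q) := by
    cases i
    · exact h.mono (le_max_left _ _)
    · exact h'.mono (le_max_right _ _)
  induction φ with
  | pos a => exact ⟨1, atom a⟩
  | neg a => exact ⟨1, fun v => (atom a v).not⟩
  | and φ ψ ih1 ih2 =>
    obtain ⟨p, hp⟩ := ih1
    obtain ⟨q, hq⟩ := ih2
    exact ⟨max p q + 1, fun v => ⟨_, lt_add_one _, fun i _ => pair (hp v) (hq v) i⟩⟩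
  | or φ ψ ih1 ih2 =>
    obtain ⟨p, hp⟩ := ih1
    obtain ⟨q, hq⟩ := ih2
    exact ⟨max p q + 1, fun v => ⟨_, lt_add_one _, fun i _ => pair (hp v) (hq v) i⟩⟩
  | all φ ih =>
    obtain ⟨p, hp⟩ := ih
    exact ⟨p + 1, fun v => ⟨_, lt_add_one _, fun i _ => hp _⟩⟩
  | ex φ ih =>
    obtain ⟨p, hp⟩ := ih
    exact ⟨p + 1, fun v => ⟨_, lt_add_one _, fun i _ => hp _⟩⟩

theorem asymHolds_toInf {φ : Formula} (hφ : φ.XFree) (A P N : Set ℕ) (v : ℕ → ℕ) :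
    (φ.toInf v).AsymHolds P N ↔ φ.Holds A v := by
  induction φ generalizing v with
  | pos a =>
    cases a with
    | X t => exact hφ.elim
    | _ =>
      simp only [toInf, Atom.toInf, Holds, Atom.Holds]
      split <;> simp_all [top, InfForm.not, AsymHolds]
  | neg a =>
    cases a with
    | X t => exact hφ.elim
    | _ =>
      simp only [toInf, Atom.toInf, Holds, Atom.Holds]
      split <;> simp_all [top, InfForm.not, AsymHolds]
  | and φ ψ ih1 ih2 => simp [toInf, Holds, asymHolds_and, ih1 hφ.1, ih2 hφ.2]
  | or φ ψ ih1 ih2 => simp [toInf, Holds, asymHolds_or, ih1 hφ.1, ih2 hφ.2]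
  | all φ ih => simp [toInf, Holds, AsymHolds, ih hφ]
  | ex φ ih => simp [toInf, Holds, AsymHolds, ih hφ]

end Formula

-- Infinitary derivations of logical and arithmetical principles

namespace InfDer

/-- Each level of the formula costs two inferences, one conjunction and one disjunction, hence the
factor 2. -/
theorem excluded_middle {r q : ℕ} {φ : InfForm} (hφ : φ.RankLT q) {Γ : Set InfForm}
    (h : φ ∈ Γ) (h' : φ.not ∈ Γ) : InfDer r (2 * q : ℕ) Γ := by
  have lt {p q : ℕ} (h : p < q) : ((2 * p : ℕ) : Ordinal.{0}) < (2 * p + 1 : ℕ) ∧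
      ((2 * p + 1 : ℕ) : Ordinal.{0}) < (2 * q : ℕ) := by
    constructor <;> rw [Nat.cast_lt] <;> omega
  induction φ generalizing q Γ with
  | pos n => exact .ax n h h'
  | neg n => exact .ax n h' h
  | conj s f ih =>
    obtain ⟨p, hp, hf⟩ := hφ
    refine .conj s f (fun _ => (2 * p + 1 : ℕ)) h (fun i hi => (lt hp).2) fun i hi => ?_
    exact .disj s (fun i => (f i).not) i (.inr h') hi (lt hp).1
      (ih i (hf i hi) (.inr (.inl rfl)) (.inl rfl))
  | disj s f ih =>
    obtain ⟨p, hp, hf⟩ := hφ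
    refine .conj s (fun i => (f i).not) (fun _ => (2 * p + 1 : ℕ)) h' (fun i hi => (lt hp).2)
      fun i hi => ?_
    exact .disj s f i (.inr h) hi (lt hp).1 (ih i (hf i hi) (.inl rfl) (.inr (.inl rfl)))

/-- Under the readings `∅` and `univ` all literals are false. Truth thus rests on empty conjunctions
alone, and its verification is itself a derivation. -/
theorem of_asymHolds {r q : ℕ} {φ : InfForm} (hφ : φ.RankLT q) (h : φ.AsymHolds ∅ .univ)
    {Γ : Set InfForm} (hΓ : φ ∈ Γ) : InfDer r q Γ := by
  induction φ generalizing q Γ with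
  | pos n => exact h.elim
  | neg n => exact (h trivial).elim
  | conj s f ih =>
    obtain ⟨p, hp, hf⟩ := hφ
    exact .conj s f (fun _ => p) hΓ (fun i hi => by exact_mod_cast hp) fun i hi =>
      ih i (hf i hi) (h i hi) (.inl rfl)
  | disj s f ih =>
    obtain ⟨p, hp, hf⟩ := hφ
    obtain ⟨i, hi, h⟩ := h
    exact .disj s f i hΓ hi (by exact_mod_cast hp) (ih i (hf i hi) h (.inl rfl))

theorem and_intro {r : ℕ} {α : Ordinal} {φ ψ : InfForm} {Γ : Set InfForm}
    (hΓ : .conj .univ (pair φ ψ) ∈ Γ) (h1 : InfDer r α (insert φ Γ))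
    (h2 : InfDer r α (insert ψ Γ)) : InfDer r (α + 1) Γ := by
  refine .conj .univ _ (fun _ => α) hΓ (fun _ _ => lt_add_one α) fun i _ => ?_
  cases i
  exacts [h1, h2]

theorem or_intro {r : ℕ} {α : Ordinal} {φ ψ : InfForm} {Γ : Set InfForm}
    (hΓ : .disj .univ (pair φ ψ) ∈ Γ) (h : InfDer r α (insert φ (insert ψ Γ))) :
    InfDer r (α + 2) Γ := by
  rw [← one_add_one_eq_two, ← add_assoc]
  exact .disj .univ _ 1 hΓ trivial (lt_add_one _)
    (.disj .univ _ 0 (.inr hΓ) trivial (lt_add_one _) h)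

/-- The instance `F n` results from `n` uses of the induction step, each of which costs a
disjunction and a conjunction. -/
theorem induction_instance {r q : ℕ} {F : ℕ → InfForm} (hF : ∀ n, (F n).RankLT q)
    {Γ : Set InfForm} (h0 : (F 0).not ∈ Γ)
    (hS : .disj .univ (fun n => .conj .univ (pair (F n) (F (n + 1)).not)) ∈ Γ) (n : ℕ) :
    InfDer r (2 * q + 2 * n : ℕ) (insert (F n) Γ) := by
  induction n with
  | zero => exact excluded_middle (hF 0) (.inl rfl) (.inr h0)
  | succ n ih =>
    have lt : ((2 * q + 2 * n + 1 : ℕ) : Ordinal.{0}) < (2 * q + 2 * (n + 1) : ℕ) := by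
      rw [Nat.cast_lt]; omega
    refine .disj .univ _ n (.inr hS) trivial lt ?_
    rw [Nat.cast_add_one]
    refine and_intro (.inl rfl) (ih.mono le_rfl le_rfl ?_)
      ((excluded_middle (hF (n + 1)) (.inr (.inr (.inl rfl))) (.inl rfl)).mono le_rfl ?_ subset_rfl)
    · exact Set.insert_subset_insert ((Set.subset_insert _ _).trans (Set.subset_insert _ _))
    · rw [Nat.cast_le]; omega

end InfDer

/-! ## Embedding of `PA[X]` -/

open Formula in
theorem Derivable.exists_infDer {Γ : Finset Formula} (h : Derivable Γ) :
    ∃ d r : ℕ, ∀ (v : ℕ → ℕ) (Θ : Set InfForm), (∀ φ ∈ Γ, φ.toInf v ∈ Θ) → InfDer r d Θ := by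
  have lt (d : ℕ) : (d : Ordinal.{0}) < (d + 1 : ℕ) := Nat.cast_lt.2 (lt_add_one d)
  induction h with
  | ax Δ a =>
    obtain ⟨q, hq⟩ := exists_rankLT_toInf (pos a)
    exact ⟨2 * q, 0, fun v Θ h => .excluded_middle (hq v) (h _ (by simp)) (h (neg a) (by simp))⟩
  | and Δ Γ φ ψ _ _ ih1 ih2 =>
    obtain ⟨d1, r1, h1⟩ := ih1
    obtain ⟨d2, r2, h2⟩ := ih2
    refine ⟨max d1 d2 + 1, max r1 r2, fun v Θ h => ?_⟩
    rw [Nat.cast_add_one]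
    refine .and_intro (h (Formula.and φ ψ) (by simp))
      ((h1 v _ fun χ hχ => ?_).mono (le_max_left _ _) (Nat.cast_le.2 (le_max_left _ _)) subset_rfl)
      ((h2 v _ fun χ hχ => ?_).mono (le_max_right _ _) (Nat.cast_le.2 (le_max_right _ _)) subset_rfl)
    all_goals
      simp only [Finset.mem_union, Finset.mem_singleton] at hχ
      rcases hχ with hχ | rfl
      · exact .inr (h χ (by simp [hχ]))
      · exact .inl rfl
  | orLeft Δ Γ φ ψ _ ih =>
    obtain ⟨d, r, ih⟩ := ih
    refine ⟨d + 1, r, fun v Θ h => .disj .univ _ 0 (h (Formula.or φ ψ) (by simp)) trivial (lt d)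
      (ih v _ fun χ hχ => ?_)⟩
    simp only [Finset.mem_union, Finset.mem_singleton] at hχ
    rcases hχ with hχ | rfl
    · exact .inr (h χ (by simp [hχ]))
    · exact .inl rfl
  | orRight Δ Γ φ ψ _ ih =>
    obtain ⟨d, r, ih⟩ := ih
    refine ⟨d + 1, r, fun v Θ h => .disj .univ _ 1 (h (Formula.or φ ψ) (by simp)) trivial (lt d)
      (ih v _ fun χ hχ => ?_)⟩
    simp only [Finset.mem_union, Finset.mem_singleton] at hχ
    rcases hχ with hχ | rfl
    · exact .inr (h χ (by simp [hχ]))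
    · exact .inl rfl
  | all Δ Γ φ y hy hy' _ ih =>
    obtain ⟨d, r, ih⟩ := ih
    -- The premise for `n` is the single finitary premise under the assignment that gives the
    -- eigenvariable the value `n`. This needs `d` and `r` to be independent of `v`.
    refine ⟨d + 1, r, fun v Θ h => .conj .univ _ (fun _ => d) (h (Formula.all φ) (by simp))
      (fun _ _ => lt d) fun n _ => ih (Function.update v y n) _ fun χ hχ => ?_⟩
    have agree {ψ : Formula} (hψ : ¬ ψ.FreeIn y) (k : ℕ) (hk : ψ.FreeIn k) :
        Function.update v y n k = v k := by
      rw [Function.update_of_ne]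
      rintro rfl
      exact hψ hk
    simp only [Finset.mem_union, Finset.mem_singleton] at hχ
    rcases hχ with hχ | rfl
    · rw [toInf_congr (agree (hy χ hχ))]
      exact .inr (h χ (by simp [hχ]))
    · refine .inl ?_
      rw [toInf_inst]
      refine toInf_congr fun k hk => ?_
      cases k with
      | zero => simp [extend, Term.val]
      | succ k => exact agree hy' k hk
  | ex Δ Γ φ t _ ih =>
    obtain ⟨d, r, ih⟩ := ih
    refine ⟨d + 1, r, fun v Θ h => .disj .univ _ (t.val v) (h (Formula.ex φ) (by simp)) trivial
      (lt d) (ih v _ fun χ hχ => ?_)⟩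
    simp only [Finset.mem_union, Finset.mem_singleton] at hχ
    rcases hχ with hχ | rfl
    · exact .inr (h χ (by simp [hχ]))
    · exact .inl (toInf_inst v φ t)
  | cut Δ Γ φ _ _ ih1 ih2 =>
    obtain ⟨d1, r1, h1⟩ := ih1
    obtain ⟨d2, r2, h2⟩ := ih2
    obtain ⟨q, hq⟩ := exists_rankLT_toInf φ
    refine ⟨max d1 d2 + 1, max q (max r1 r2), fun v Θ h => ?_⟩
    refine .cut (φ.toInf v) ((hq v).mono (le_max_left _ _)) (lt _) (lt _)
      ((h1 v _ fun χ hχ => ?_).mono (by simp) (Nat.cast_le.2 (le_max_left _ _)) subset_rfl)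
      ((h2 v _ fun χ hχ => ?_).mono (by simp) (Nat.cast_le.2 (le_max_right _ _)) subset_rfl)
    all_goals
      simp only [Finset.mem_union, Finset.mem_singleton] at hχ
      rcases hχ with hχ | rfl
      · exact .inr (h χ (by simp [hχ]))
    · exact .inl rfl
    · exact .inl (toInf_not v φ)

open scoped Ordinal in
theorem add_lt_epsilon_zero {α β : Ordinal} (hα : α < ε₀) (hβ : β < ε₀) : α + β < ε₀ := by
  rw [← omega0_opow_epsilon 0] at *
  exact isPrincipal_add_omega0_opow _ hα hβ

open scoped Ordinal in
/-- The sequent has an infinitary derivation of height below `ε₀` and with finite cut rank. -/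
def InfProvable (Γ : Set InfForm) : Prop :=
  ∃ α < ε₀, ∃ r, InfDer r α Γ

namespace InfProvable

theorem mono {Γ Γ' : Set InfForm} (h : InfProvable Γ) (hΓ : Γ ⊆ Γ') : InfProvable Γ' := by
  obtain ⟨α, hα, r, h⟩ := h
  exact ⟨α, hα, r, h.mono le_rfl le_rfl hΓ⟩

theorem cut {Γ : Set InfForm} {φ : InfForm} {q : ℕ} (hφ : φ.RankLT q)
    (h1 : InfProvable (insert φ Γ)) (h2 : InfProvable (insert φ.not Γ)) : InfProvable Γ := by
  obtain ⟨α, hα, r1, h1⟩ := h1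
  obtain ⟨β, hβ, r2, h2⟩ := h2
  refine ⟨max α β + 1, add_lt_epsilon_zero (max_lt hα hβ) (by simpa using natCast_lt_epsilon 1 0),
    max q (max r1 r2), ?_⟩
  exact .cut φ (hφ.mono (by simp)) (lt_add_one _) (lt_add_one _)
    (h1.mono (by simp) (le_max_left _ _) subset_rfl)
    (h2.mono (by simp) (le_max_right _ _) subset_rfl)

end InfProvable

-- Infinitary provability of the axioms

open scoped Ordinal in
/-- All instances of the formula have infinitary derivations with a common height below `ε₀` and a
common finite cut rank. -/
def Formula.OmegaProvable (φ : Formula) : Prop :=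
  ∃ α < ε₀, ∃ r, ∀ v, InfDer r α {φ.toInf v}

namespace Formula

/-- As the height is common to all assignments, one ω-branching inference per quantifier suffices.
-/
theorem OmegaProvable.allN {φ : Formula} (h : φ.OmegaProvable) (n : ℕ) :
    (allN n φ).OmegaProvable := by
  induction n with
  | zero => exact h
  | succ n ih =>
    obtain ⟨α, hα, r, h⟩ := ih
    exact ⟨α + 1, add_lt_epsilon_zero hα (by simpa using natCast_lt_epsilon 1 0), r,
      fun v => .conj .univ _ (fun _ => α) rfl (fun _ _ => lt_add_one α)
        fun i _ => (h (extend i v)).mono le_rfl le_rfl (by simp)⟩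

theorem OmegaProvable.of_xFree {φ : Formula} (hφ : φ.XFree) (h : ∀ v, φ.Holds ∅ v) :
    φ.OmegaProvable := by
  obtain ⟨q, hq⟩ := φ.exists_rankLT_toInf
  exact ⟨q, natCast_lt_epsilon q 0, 0, fun v =>
    .of_asymHolds (hq v) ((asymHolds_toInf hφ _ _ _ v).2 (h v)) rfl⟩

theorem OmegaProvable.inductionAxiom (φ : Formula) : (inductionAxiom φ).OmegaProvable := by
  obtain ⟨q, hq⟩ := φ.exists_rankLT_toInf
  have two : (2 : Ordinal.{0}) < epsilon 0 := by simpa using natCast_lt_epsilon 2 0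
  -- The instances have unbounded finite heights, hence `ω`. The two nested disjunctions of the
  -- axiom add 2 each.
  refine ⟨ω + 2 + 2, add_lt_epsilon_zero (add_lt_epsilon_zero (omega0_lt_epsilon 0) two) two,
    0, fun v => ?_⟩
  simp only [Gentzen.inductionAxiom, imp, not, toInf, toInf_not, toInf_inst, toInf_substSucc,
    InfForm.not_not, Term.val]
  refine .or_intro rfl (.or_intro (.inl rfl) ?_)
  refine .conj .univ (fun n => φ.toInf (extend n v)) (fun n => (2 * q + 2 * n : ℕ)) (by simp)
    (fun n _ => natCast_lt_omega0 _) fun n _ =>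
      .induction_instance (F := fun n => φ.toInf (extend n v)) (fun n => hq _) ?_ ?_ n
  · exact .inl rfl
  · exact .inr (.inl rfl)

theorem OmegaProvable.eq_X (s t : Term) :
    (imp (.and (pos (.eq s t)) (pos (.X s))) (pos (.X t))).OmegaProvable := by
  have one : (1 : Ordinal.{0}) < epsilon 0 := by simpa using natCast_lt_epsilon 1 0
  have two : (2 : Ordinal.{0}) < epsilon 0 := by simpa using natCast_lt_epsilon 2 0
  refine ⟨1 + 2 + 2, add_lt_epsilon_zero (add_lt_epsilon_zero one two) two, 0, fun v => ?_⟩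
  simp only [imp, not, toInf, Atom.toInf]
  refine .or_intro rfl (.or_intro (.inl rfl) ?_)
  split_ifs with h
  · rw [h]
    exact .ax (t.val v) (by simp) (by simp [InfForm.not])
  -- A false equation has a true negation, an empty conjunction, which is derived without premises.
  · exact .conj ∅ (fun _ => .pos 0) (fun _ => 0) (by simp [top, InfForm.not]) (by simp) (by simp)

end Formula

open Formula in
-- Apart from induction and the equality axiom for `X`, all axioms are true and free of `X`, and
-- `OmegaProvable.of_xFree` applies.
theorem IsAxiom.omegaProvable {φ : Formula} (h : IsAxiom φ) : φ.OmegaProvable := by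
  cases h with
  | eq_X => exact (OmegaProvable.eq_X _ _).allN 2
  | induction φ n => exact (OmegaProvable.inductionAxiom φ).allN n
  | eq_succ_of_ne_zero =>
    refine .of_xFree (by simp [imp, Formula.not, XFree, Atom.XFree]) fun v => ?_
    simp only [Holds, imp, Formula.not, Atom.Holds, Term.val, extend]
    exact fun n => n.casesOn (.inl rfl) fun k => .inr ⟨k, rfl⟩
  | le_iff =>
    refine .of_xFree (by simp [allN, Formula.iff, imp, Formula.not, XFree, Atom.XFree]) fun v => ?_
    simp only [allN, Holds, Formula.iff, imp, Formula.not, Atom.Holds, Term.val, extend]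
    intro m n
    refine ⟨?_, ?_⟩
    · by_cases hmn : m ≤ n
      · exact .inr ⟨n - m, by omega⟩
      · exact .inl hmn
    · by_cases hmn : m ≤ n
      · exact .inr hmn
      · exact .inl fun k => by omega
  | _ =>
    refine .of_xFree (by simp [allN, imp, Formula.not, XFree, Atom.XFree]) fun v => ?_
    simp only [allN, Holds, imp, Formula.not, Atom.Holds, Term.val, extend]
    intros
    first
      | rfl
      | omega
      | (rw [← not_and_or, ← imp_iff_not_or]; rintro ⟨rfl, rfl⟩; rfl)
      | grind

/-- The negated axioms are removed from the embedded sequent by one cut each. -/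
theorem PAXProves.infProvable {φ : Formula} (h : PAXProves φ) (v : ℕ → ℕ) :
    InfProvable {φ.toInf v} := by
  obtain ⟨Ψ, hΨ, hder⟩ := h
  obtain ⟨d, r, h⟩ := hder.exists_infDer
  have start : InfProvable ({φ.toInf v} ∪ {χ | ∃ ψ ∈ Ψ, χ = (ψ.toInf v).not}) := by
    refine ⟨d, natCast_lt_epsilon d 0, r, h v _ fun χ hχ => ?_⟩
    simp only [Finset.mem_union, Finset.mem_image, Finset.mem_singleton] at hχ
    rcases hχ with ⟨ψ, hψ, rfl⟩ | rfl
    · exact .inr ⟨ψ, hψ, ψ.toInf_not v⟩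
    · exact .inl rfl
  clear h hder
  induction Ψ using Finset.induction_on with
  | empty => exact start.mono (by simp)
  | insert ψ Ψ _ ih =>
    refine ih (fun χ hχ => hΨ χ (Finset.mem_insert_of_mem hχ)) ?_
    obtain ⟨q, hq⟩ := ψ.exists_rankLT_toInf
    obtain ⟨α, hα, r, hψ⟩ := (hΨ ψ (Finset.mem_insert_self _ _)).omegaProvable
    refine .cut (hq v) ⟨α, hα, r, (hψ v).mono le_rfl le_rfl (by simp)⟩ (start.mono ?_)
    rintro χ (hχ | ⟨χ, hχ, rfl⟩)
    · exact .inr (.inl hχ)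
    · rcases Finset.mem_insert.1 hχ with rfl | hχ
      · exact .inl rfl
      · exact .inr (.inr ⟨χ, hχ, rfl⟩)

end Gentzen

namespace Gentzen

open Ordinal

/-! ## Ordinal values of the notations -/

namespace Tree

mutual

/-- The ordinal `ω ^ α₀ + ... + ω ^ αₙ₋₁` denoted by `⟨α₀, ..., αₙ₋₁⟩`. -/
noncomputable def ord : Tree → Ordinal.{0}
  | .node l => ordList l

noncomputable def ordList : List Tree → Ordinal.{0}
  | [] => 0
  | a :: l => ω ^ a.ord + ordList l

end

theorem ordList_append (l m : List Tree) : ordList (l ++ m) = ordList l + ordList m := by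
  induction l with
  | nil => simp [ordList]
  | cons a l ih => simp [ordList, ih, add_assoc]

theorem ordList_lt {l : List Tree} {γ : Ordinal} (h : ∀ a ∈ l, a.ord < γ) :
    ordList l < ω ^ γ := by
  induction l with
  | nil => exact opow_pos γ omega0_pos
  | cons a l ih =>
    exact isPrincipal_add_omega0_opow γ
      ((opow_lt_opow_iff_right one_lt_omega0).2 (h a (.head _)))
      (ih fun b hb => h b (.tail _ hb))

theorem sizeOf_lt_node {a : Tree} {l : List Tree} (h : a ∈ l) : sizeOf a < sizeOf (node l) := by
  have := List.sizeOf_lt_of_mem h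
  simp only [node.sizeOf_spec]
  omega

/-- From the first difference on, the exponents on the left are non-increasing, hence all below that
of `b`. Their sum of `ω`-powers is thus smaller than the single term `ω ^ b.ord`. -/
theorem Prec.ord_lt {a b : Tree} (h : Prec a b) (ha : a.MemEpsilonZero) (hb : b.MemEpsilonZero) :
    a.ord < b.ord := by
  -- The induction hypothesis must also compare entries of the left list with each other, so the
  -- induction is on a common bound for both sizes.
  suffices ∀ n, ∀ a b : Tree, sizeOf a < n → sizeOf b < n → Prec a b → a.MemEpsilonZero →
      b.MemEpsilonZero → a.ord < b.ord from
    this (sizeOf a + sizeOf b + 1) a b (by omega) (by omega) h ha hb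
  clear h ha hb
  intro n
  induction n with
  | zero => intro a b h; omega
  | succ n ih =>
    intro a b hsa hsb h ha hb
    cases h with
    | initial l b s =>
      rw [ord, ord, ordList_append, ordList]
      exact lt_add_of_pos_right _ ((opow_pos _ omega0_pos).trans_le le_self_add)
    | diff l a b r s h =>
      obtain ⟨_, hma, hch⟩ := ha
      obtain ⟨_, hmb, -⟩ := hb
      have size {x : Tree} (hx : x ∈ l ++ a :: r) : sizeOf x < n := by
        have := sizeOf_lt_node hx
        omega
      have hab : a.ord < b.ord := by
        refine ih a b (size (by simp)) ?_ h (hma a (by simp)) (hmb b (by simp))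
        have := sizeOf_lt_node (a := b) (l := l ++ b :: s) (by simp)
        omega
      have pw : (l ++ a :: r).Pairwise (fun x y => y.ord ≤ x.ord) := by
        have : IsTrans Tree (fun x y => y.ord ≤ x.ord) := ⟨fun _ _ _ h h' => h'.trans h⟩
        refine List.IsChain.pairwise (hch.imp_of_mem_imp ?_)
        rintro x y hx hy (hxy | rfl)
        · exact (ih y x (size hy) (size hx) hxy (hma y hy) (hma x hx)).le
        · exact le_rfl
      have har := (List.pairwise_cons.1 (List.pairwise_append.1 pw).2.1).1
      rw [ord, ord, ordList_append, ordList_append, ordList.eq_2 b s]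
      refine (add_lt_add_iff_left _).2 (lt_of_lt_of_le (ordList_lt ?_) le_self_add)
      simpa using ⟨hab, fun x hx => (har x hx).trans_lt hab⟩

theorem Prec.cons {l m : List Tree} (a : Tree) (h : Prec (node l) (node m)) :
    Prec (node (a :: l)) (node (a :: m)) := by
  cases h with
  | initial l b s => exact .initial (a :: l) b s
  | diff l x y r s h => exact .diff (a :: l) x y r s h

theorem prec_trichotomy (a b : Tree) : Prec a b ∨ a = b ∨ Prec b a := by
  match a, b with
  | node [], node [] => exact .inr (.inl rfl)
  | node [], node (b :: m) => exact .inl (.initial [] b m)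
  | node (a :: l), node [] => exact .inr (.inr (.initial [] a l))
  | node (a :: l), node (b :: m) =>
    rcases prec_trichotomy a b with h | rfl | h
    · exact .inl (.diff [] a b l m h)
    · rcases prec_trichotomy (node l) (node m) with h | h | h
      · exact .inl (h.cons a)
      · cases h
        exact .inr (.inl rfl)
      · exact .inr (.inr (h.cons a))
    · exact .inr (.inr (.diff [] b a m l h))

theorem prec_of_ord_lt {a b : Tree} (ha : a.MemEpsilonZero) (hb : b.MemEpsilonZero)
    (h : a.ord < b.ord) : Prec a b := by
  rcases prec_trichotomy a b with h' | rfl | h'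
  · exact h'
  · exact absurd h (lt_irrefl _)
  · exact absurd h (h'.ord_lt hb ha).asymm

theorem prec_or_eq_of_ord_le {a b : Tree} (ha : a.MemEpsilonZero) (hb : b.MemEpsilonZero)
    (h : a.ord ≤ b.ord) : Prec a b ∨ a = b := by
  rcases prec_trichotomy a b with h' | rfl | h'
  · exact .inl h'
  · exact .inr rfl
  · exact absurd (h'.ord_lt hb ha) h.not_gt

open scoped Ordinal in
theorem MemEpsilonZero.ord_lt_epsilon_zero {a : Tree} (ha : a.MemEpsilonZero) : a.ord < ε₀ := by
  induction ha with
  | node l _ _ ih =>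
    rw [ord, ← omega0_opow_epsilon 0]
    exact ordList_lt ih

-- Cantor normal form: split off the leading power of `ω` from `γ`. The exponent is smaller than `γ`
-- because `ε₀` is the least fixed point of `ω ^ ·`.
open scoped Ordinal in
theorem exists_ord_eq {γ : Ordinal} (hγ : γ < ε₀) : ∃ a : Tree, a.MemEpsilonZero ∧ a.ord = γ := by
  induction γ using WellFoundedLT.induction with
  | ind γ ih =>
    rcases eq_or_ne γ 0 with rfl | h0
    · exact ⟨node [], ⟨_, by simp, .nil⟩, rfl⟩
    have hlog : log ω γ < γ := by
      rw [← lt_opow_iff_log_lt one_lt_omega0 h0]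
      by_contra! h
      exact hγ.not_ge (epsilon_zero_le_of_omega0_opow_le h)
    have hsub : γ - ω ^ log ω γ < γ := (isLeast_sub_lt_omega0_opow_log h0).1
    obtain ⟨a, ha, hae⟩ := ih _ hlog (hlog.trans hγ)
    obtain ⟨⟨l⟩, hl, hle⟩ := ih _ hsub (hsub.trans hγ)
    refine ⟨node (a :: l), ?_, ?_⟩
    · obtain ⟨_, hl, hch⟩ := hl
      refine ⟨_, by simpa using ⟨ha, hl⟩, ?_⟩
      cases l with
      | nil => exact .singleton a
      | cons b l =>
        refine .cons_cons (prec_or_eq_of_ord_le (hl b (.head _)) ha ?_) hch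
        -- The leading term of the remainder is at most `γ`, so its exponent is at most `log ω γ`.
        rw [hae, ← opow_le_iff_le_log one_lt_omega0 h0]
        refine le_trans ?_ hsub.le
        rw [← hle, ord, ordList]
        exact le_self_add
    · rw [ord, ordList, hae]
      rw [ord] at hle
      rw [hle, Ordinal.add_sub_cancel_of_le (opow_log_le_self ω h0)]

end Tree

/-! ## Unprovability of transfinite induction -/

theorem Formula.holds_not {A : Set ℕ} {v : ℕ → ℕ} {φ : Formula} :
    φ.not.Holds A v ↔ ¬ φ.Holds A v := by
  induction φ generalizing v <;> simp_all [Formula.not, Holds, imp_iff_not_or]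

theorem Formula.XFree.not {φ : Formula} (h : φ.XFree) : φ.not.XFree := by
  induction φ <;> simp_all [Formula.not, Formula.XFree]

theorem Formula.asymHolds_not_toInf {φ : Formula} (hφ : φ.XFree) (A P N : Set ℕ) (v : ℕ → ℕ) :
    (φ.toInf v).not.AsymHolds P N ↔ ¬ φ.Holds A v := by
  rw [← toInf_not, asymHolds_toInf hφ.not A, holds_not]

/-- The codes of terms with ordinal value below `γ`. -/
def codesBelow (c : EpsilonZero → ℕ) (γ : Ordinal) : Set ℕ :=
  {n | ∃ α, c α = n ∧ α.1.ord < γ}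

theorem codesBelow_mono (c : EpsilonZero → ℕ) : Monotone (codesBelow c) :=
  fun _ _ h _ ⟨α, hα, hlt⟩ => ⟨α, hα, hlt.trans_le h⟩

theorem mem_codesBelow_add_one {c : EpsilonZero → ℕ} {γ : Ordinal} {α : EpsilonZero}
    (h : ∀ β : EpsilonZero, Tree.Prec β.1 α.1 → c β ∈ codesBelow c γ) (hc : c.Injective) :
    c α ∈ codesBelow c (γ + 1) := by
  refine ⟨α, rfl, Order.lt_add_one_iff.2 ?_⟩
  by_contra! hlt
  -- If the value of `α` exceeded `γ`, a notation for `γ` itself would precede `α`.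
  obtain ⟨b, hb, rfl⟩ := Tree.exists_ord_eq (hlt.trans α.2.ord_lt_epsilon_zero)
  obtain ⟨β, hβ, hlt'⟩ := h ⟨b, hb⟩ (Tree.prec_of_ord_lt hb α.2 hlt)
  cases hc hβ
  exact lt_irrefl _ hlt'

/-- This is the hypothesis `hg` of `InfDer.boundedness`. A counterexample to progressivity at `n`
asserts `X` of all predecessors, which puts `n` into the next stage, and also denies `X` of `n`. -/
theorem notProg_inst_asymHolds {c : EpsilonZero → ℕ} (hc : c.Injective) {δ ρ : Formula}
    (hδ : DefinesField c δ) (hρ : DefinesPrec c ρ) (v : ℕ → ℕ) (n : ℕ)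
    (_ : n ∈ (Set.univ : Set ℕ)) (γ : Ordinal) (N P : Set ℕ)
    (h : ((Formula.imp δ (.imp (.all (.imp ρ (.pos (.X (.var 0))))) (.pos (.X (.var 0))))).toInf
      (extend n v)).not.AsymHolds (codesBelow c γ) N) :
    ¬ ((Formula.imp δ (.imp (.all (.imp ρ (.pos (.X (.var 0))))) (.pos (.X (.var 0))))).toInf
      (extend n v)).not.AsymHolds P (codesBelow c (γ + 1)) := by
  intro h'
  simp only [Formula.imp, Formula.not, Formula.toInf, InfForm.not, InfForm.not_pair,
    InfForm.asymHolds_and, Formula.toInf_not, InfForm.not_not,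
    Formula.asymHolds_toInf hδ.1 ∅, hδ.2.2, Atom.toInf] at h h'
  obtain ⟨⟨α, hα⟩, hprog, -⟩ := h
  refine h'.2.2 ?_
  change n ∈ _
  rw [← show c α = n from hα]
  refine mem_codesBelow_add_one (fun β hβ => ?_) hc
  have := hprog (c β) trivial
  rw [InfForm.asymHolds_or, Formula.asymHolds_not_toInf hρ.1 ∅, hρ.2.2] at this
  exact this.resolve_left fun h => h ⟨β, α, hβ, rfl, hα⟩

theorem not_paxProves_tiFormula {c : EpsilonZero → ℕ} (hc : Function.Injective c)
    {δ ρ : Formula} (hδ : DefinesField c δ) (hρ : DefinesPrec c ρ) :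
    ¬ PAXProves (tiFormula δ ρ) := by
  intro h
  let v : ℕ → ℕ := fun _ => 0
  obtain ⟨q, hq⟩ := (tiFormula δ ρ).exists_rankLT_toInf
  obtain ⟨p, hp⟩ := (progFormula δ ρ).exists_rankLT_toInf
  set C : Formula := .all (.imp δ (.pos (.X (.var 0)))) with hC
  obtain ⟨r, hr⟩ := C.exists_rankLT_toInf
  have inv : InfProvable {((progFormula δ ρ).toInf v).not, C.toInf v} := by
    -- The implication is inverted by a cut: its negation, the conjunction of progressivity and
    -- `C.not`, is refuted by excluded middle.
    refine .cut (hq v) ((h.infProvable v).mono (by simp)) ?_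
    refine ⟨(2 * max p r : ℕ) + 1, by exact_mod_cast natCast_lt_epsilon (2 * max p r + 1) 0, 0, ?_⟩
    rw [tiFormula, Formula.imp, Formula.toInf, Formula.toInf_not, InfForm.not, InfForm.not_pair]
    exact .and_intro (.inl rfl)
      (.excluded_middle ((hp v).not.mono (le_max_left p r)) (by simp) (by simp))
      (.excluded_middle ((hr v).mono (le_max_right p r)) (by simp [hC]) (by simp [hC]))
  obtain ⟨α, hα, _, hder⟩ := inv
  obtain ⟨β, hβ, hder⟩ := hder.cut_elimination hα
  obtain ⟨_, rfl, hφ⟩ := InfDer.boundedness (Δ := {C.toInf v}) (codesBelow_mono c)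
    (notProg_inst_asymHolds hc hδ hρ v) hder subset_rfl 0
  -- A notation for the bound `ω ^ β` itself cannot have value below it.
  obtain ⟨t, ht, hte⟩ := Tree.exists_ord_eq (InfDer.omega0_opow_lt_epsilon_zero hβ)
  rcases InfForm.asymHolds_or.1 (hφ (c ⟨t, ht⟩) trivial) with h | h
  · rw [Formula.toInf_not, Formula.asymHolds_not_toInf hδ.1 ∅, hδ.2.2] at h
    exact h ⟨_, rfl⟩
  · obtain ⟨s, hs, hlt⟩ := h
    cases hc hs
    rw [zero_add, hte] at hlt
    exact lt_irrefl _ hlt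

end Gentzen

/-- Gentzen's theorem: `PA[X]` does not prove transfinite induction along `ε₀`, for whatever coding
`c` of the terms by natural numbers and whatever formulas `δ`, `ρ` of the language of Peano arithmetic
that define the set of codes and the coded order. -/
theorem theorem5p6 (c : Gentzen.EpsilonZero → ℕ) (hc : Function.Injective c)
    (δ ρ : Gentzen.Formula) (hδ : Gentzen.DefinesField c δ) (hρ : Gentzen.DefinesPrec c ρ) :
    ¬ Gentzen.PAXProves (Gentzen.tiFormula δ ρ) :=
  Gentzen.not_paxProves_tiFormula hc hδ hρ
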